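/- Let $M$ be a smooth $n$-dimensional manifold. Let $\pi\colon FM\to M$ be its frame bundle, whose points over $x\in M$ are the linear isomorphisms $u\colon\mathbb R^n\to T_xM$; it is a principal $GL(n)$-bundle with right action $R_a(u)=u\circ a$. Let $q\colon \mathrm{Sym}^+M\to M$ be the bundle of symmetric positive definite covariant $2$-tensors on $M$, and let $\Sigma\colon FM\to \mathrm{Sym}^+M$ be the map $$\Sigma(u)(v,w)=\langle u^{-1}v,u^{-1}w\rangle_{\mathbb R^n},\qquad v,w\in T_{\pi(u)}M,$$ so that $q\circ\Sigma=\pi$. Let $\mathcal H$ be a principal connection on $FM$, i.e. a smooth distribution such that $TFM=\mathcal H\oplus\ker\pi_*$ is a smooth splitting and $(R_a)_*\mathcal H_u=\mathcal H_{R_a(u)}$ for all $u\in FM$ and $a\in GL(n)$. **Proposition.** There is a unique distribution $\mathcal H^S$ on $\mathrm{Sym}^+M$ such that $\Sigma_*\mathcal H_u=\mathcal H^S_{\Sigma(u)}$ for all $u\in FM$ and such that $$T\,\mathrm{Sym}^+M=\mathcal H^S\oplus\ker q_*$$ is a smooth splitting. In particular, for every $\sigma\in \mathrm{Sym}^+M$,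 each $v\in T_{q(\sigma)}M$ has a unique horizontal lift to $\mathcal H^S_\sigma$, i.e. there is a unique $w\in\mathcal H^S_\sigma$ with $q_*w=v$. -/

import Mathlib

open scoped Manifold ContDiff

namespace FrameSym

noncomputable section

/-! ### Smooth distributions and smooth splittings -/

section Distribution

variable {E : Type*} [NormedAddCommGroup E] [NormedSpace ℝ E]
  {H : Type*} [TopologicalSpace H] {I : ModelWithCorners ℝ E H}
  {N : Type*} [TopologicalSpace N] [ChartedSpace H N] [IsManifold I ∞ N]

/-- A smooth distribution on `N` (a smooth subbundle of `TN`): around every point the subspaces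
`D q` have a basis given by smooth local vector fields. -/
def IsSmoothDistribution (D : ∀ p : N, Submodule ℝ (TangentSpace I p)) : Prop :=
  ∀ p : N, ∃ (k : ℕ) (U : Set N) (X : Fin k → ∀ q : N, TangentSpace I q),
    IsOpen U ∧ p ∈ U ∧
    (∀ i, ContMDiffOn I I.tangent ∞ (fun q => (⟨q, X i q⟩ : TangentBundle I N)) U) ∧
    ∀ q ∈ U, LinearIndependent ℝ (fun i => X i q) ∧
      Submodule.span ℝ (Set.range fun i => X i q) = D q

/-- A smooth splitting `TN = A ⊕ B`. -/
def IsSmoothSplitting (A B : ∀ p : N, Submodule ℝ (TangentSpace I p)) : Prop :=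
  IsSmoothDistribution A ∧ IsSmoothDistribution B ∧ ∀ p, IsCompl (A p) (B p)

end Distribution

variable {n : ℕ} {M : Type*} [TopologicalSpace M] [ChartedSpace (EuclideanSpace ℝ (Fin n)) M]
  [IsManifold (𝓡 n) ∞ M]

/-! ### The frame bundle -/

variable (n M) in
/-- The total space of the smooth vector bundle `Hom(ℝⁿ, TM)` over `M`. -/
abbrev HomBundle : Type _ :=
  Bundle.TotalSpace (EuclideanSpace ℝ (Fin n) →L[ℝ] EuclideanSpace ℝ (Fin n))
    (fun x : M => Bundle.Trivial M (EuclideanSpace ℝ (Fin n)) x →L[ℝ] TangentSpace (𝓡 n) x)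

theorem isOpen_setOf_isInvertible : IsOpen {p : HomBundle n M | p.2.IsInvertible} := by
  rw [isOpen_iff_mem_nhds]
  intro p hp
  let E := EuclideanSpace ℝ (Fin n)
  let e := trivializationAt (E →L[ℝ] E)
    (fun x : M => Bundle.Trivial M E x →L[ℝ] TangentSpace (𝓡 n) x) p.1
  have hp' : p ∈ e.source := FiberBundle.mem_trivializationAt_proj_source
  have key : ∀ q ∈ e.source, (e q).2.IsInvertible ↔ q.2.IsInvertible := by
    intro q hq
    have hq' := e.mem_source.1 hq
    change (ContinuousLinearMap.inCoordinates E (Bundle.Trivial M E) E (TangentSpace (𝓡 n))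
      p.1 q.1 p.1 q.1 q.2).IsInvertible ↔ _
    rw [ContinuousLinearMap.inCoordinates_eq hq'.1 hq'.2]
    simp
  have hopen : IsOpen {A : E →L[ℝ] E | A.IsInvertible} := ContinuousLinearEquiv.isOpen
  have hcont : ContinuousAt (fun q => (e q).2) p := continuousAt_snd.comp (e.continuousAt hp')
  filter_upwards [hcont.preimage_mem_nhds (hopen.mem_nhds ((key p hp').2 hp)),
    e.open_source.mem_nhds hp'] with q h1 h2
  exact (key q h2).1 h1

variable (n M) in
/-- The frame bundle `FM`, the open submanifold of `Hom(ℝⁿ, TM)` of pairs of a point `x` and an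
isomorphism `u : ℝⁿ → T_xM`. -/
def FrameBundle : TopologicalSpace.Opens (HomBundle n M) :=
  ⟨{p | p.2.IsInvertible}, isOpen_setOf_isInvertible⟩

variable (n) in
/-- The model with corners (without boundary) of the frame bundle. -/
abbrev frameModel := (𝓡 n).prod 𝓘(ℝ, EuclideanSpace ℝ (Fin n) →L[ℝ] EuclideanSpace ℝ (Fin n))

/-- The projection `π : FM → M`. -/
def frameProj (u : FrameBundle n M) : M := u.1.1

/-- The right action `u ↦ u ∘ a` of `a ∈ GL(n)` on `FM`. -/
def frameAct (a : EuclideanSpace ℝ (Fin n) ≃L[ℝ] EuclideanSpace ℝ (Fin n))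
    (u : FrameBundle n M) : FrameBundle n M :=
  ⟨⟨u.1.1, u.1.2.comp a.toContinuousLinearMap⟩, u.2.comp ContinuousLinearMap.isInvertible_equiv⟩

variable (n M) in
/-- The vertical bundle `ker π_*`. -/
def vertical (u : FrameBundle n M) : Submodule ℝ (TangentSpace (frameModel n) u) :=
  (mfderiv (frameModel n) (𝓡 n) (frameProj (n := n) (M := M)) u).ker

/-- `𝓗` is (the horizontal distribution of) a principal connection on `FM`: `TFM = 𝓗 ⊕ ker π_*` is
a smooth splitting that is invariant under the right action of `GL(n)`. -/
structure IsPrincipalConnection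
    (𝓗 : ∀ u : FrameBundle n M, Submodule ℝ (TangentSpace (frameModel n) u)) : Prop where
  isSmoothSplitting : IsSmoothSplitting 𝓗 (vertical n M)
  invariant : ∀ (a : EuclideanSpace ℝ (Fin n) ≃L[ℝ] EuclideanSpace ℝ (Fin n))
    (u : FrameBundle n M),
    (𝓗 u).map (mfderiv (frameModel n) (frameModel n) (frameAct a) u).toLinearMap =
      𝓗 (frameAct a u)

/-! ### The bundle of symmetric positive definite covariant 2-tensors -/

variable (n) in
/-- The vector space of symmetric bilinear forms on `ℝⁿ`, a form `B` being given by its coordinates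
`B i j = B(eᵢ, eⱼ)` in the standard basis. -/
def symForms : Submodule ℝ (Fin n → Fin n → ℝ) where
  carrier := {B | ∀ i j, B i j = B j i}
  add_mem' hA hB i j := by simp [hA i j, hB i j]
  zero_mem' i j := rfl
  smul_mem' c B hB i j := by simp [hB i j]

/-- The value `B(v, w)` of a symmetric bilinear form. -/
def formEval (B : symForms n) (v w : EuclideanSpace ℝ (Fin n)) : ℝ :=
  ∑ i, ∑ j, B.1 i j * (v i * w j)

theorem formEval_symm (B : symForms n) (v w : EuclideanSpace ℝ (Fin n)) :
    formEval B v w = formEval B w v := by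
  unfold formEval
  rw [Finset.sum_comm]
  refine Finset.sum_congr rfl fun i _ => Finset.sum_congr rfl fun j _ => ?_
  rw [B.2 j i, mul_comm (v j)]

theorem formEval_single (B : symForms n) (i j : Fin n) :
    formEval B (EuclideanSpace.single i 1) (EuclideanSpace.single j 1) = B.1 i j := by
  simp [formEval]

theorem symForms_ext {A B : symForms n} (h : ∀ v w, formEval A v w = formEval B v w) : A = B := by
  ext i j
  rw [← formEval_single, ← formEval_single, h]

/-- The linear map `B ↦ B(L·, L·)` on symmetric bilinear forms. -/
def symPullback (L : EuclideanSpace ℝ (Fin n) →L[ℝ] EuclideanSpace ℝ (Fin n)) :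
    symForms n →L[ℝ] symForms n :=
  LinearMap.toContinuousLinearMap
    { toFun B := ⟨fun i j =>
        formEval B (L (EuclideanSpace.single i 1)) (L (EuclideanSpace.single j 1)),
        fun _ _ => formEval_symm _ _ _⟩
      map_add' A B := by
        ext i j
        simp [formEval, add_mul, Finset.sum_add_distrib]
      map_smul' c B := by
        ext i j
        simp [formEval, mul_assoc, Finset.mul_sum] }

theorem eq_sum_single (v : EuclideanSpace ℝ (Fin n)) :
    v = ∑ i, v i • EuclideanSpace.single i (1 : ℝ) := by
  ext j
  simp [Pi.single_apply]

theorem formEval_map_left (L : EuclideanSpace ℝ (Fin n) →L[ℝ] EuclideanSpace ℝ (Fin n))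
    (B : symForms n) (v w : EuclideanSpace ℝ (Fin n)) :
    formEval B (L v) w = ∑ i, v i * formEval B (L (EuclideanSpace.single i 1)) w := by
  let f : EuclideanSpace ℝ (Fin n) →ₗ[ℝ] ℝ :=
    { toFun v := formEval B v w
      map_add' x y := by simp [formEval, add_mul, mul_add, Finset.sum_add_distrib]
      map_smul' c x := by simp [formEval, mul_assoc, mul_left_comm, Finset.mul_sum] }
  change f (L v) = ∑ i, v i * f (L (EuclideanSpace.single i 1))
  conv_lhs => rw [eq_sum_single v]
  simp

theorem formEval_symPullback (L : EuclideanSpace ℝ (Fin n) →L[ℝ] EuclideanSpace ℝ (Fin n))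
    (B : symForms n) (v w : EuclideanSpace ℝ (Fin n)) :
    formEval (symPullback L B) v w = formEval B (L v) (L w) := by
  change ∑ i, ∑ j, formEval B (L (EuclideanSpace.single i 1)) (L (EuclideanSpace.single j 1)) *
    (v i * w j) = _
  rw [formEval_map_left]
  refine Finset.sum_congr rfl fun i _ => ?_
  rw [formEval_symm B _ (L w), formEval_map_left, Finset.mul_sum]
  refine Finset.sum_congr rfl fun j _ => ?_
  rw [formEval_symm B (L (EuclideanSpace.single j 1))]
  ring

theorem contDiff_symPullback : ContDiff ℝ ∞ (symPullback (n := n)) := by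
  obtain ⟨g, hg⟩ := (symForms n).subtype.exists_leftInverse_of_injective (symForms n).ker_subtype
  rw [contDiff_clm_apply_iff]
  intro B
  have h : (fun L => symPullback L B) =
      fun L => g.toContinuousLinearMap ((symForms n).subtype (symPullback L B)) := by
    funext L
    exact (LinearMap.congr_fun hg (symPullback L B)).symm
  rw [h]
  refine g.toContinuousLinearMap.contDiff.comp ?_
  rw [contDiff_pi]
  intro i
  rw [contDiff_pi]
  intro j
  change ContDiff ℝ ∞ fun L : EuclideanSpace ℝ (Fin n) →L[ℝ] EuclideanSpace ℝ (Fin n) =>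
    ∑ k, ∑ l, B.1 k l * (L (EuclideanSpace.single i 1) k * L (EuclideanSpace.single j 1) l)
  fun_prop

variable (n M) in
/-- The vector bundle `Sym² T*M` of symmetric covariant 2-tensors on `M`. As for Mathlib's tangent
bundle, of which this reuses the charts and the cocycle, the fibre over `x` consists of the
symmetric bilinear forms on `T_xM`, where `T_xM` is `ℝⁿ` by definition, and a form that is `B` in
the chart `i` is `B(L·, L·)` in the chart `j`, where `L` is the change of coordinates of tangent
vectors from `j` to `i`. -/
def symCore : VectorBundleCore ℝ M (symForms n) (atlas (EuclideanSpace ℝ (Fin n)) M) where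
  baseSet := (tangentBundleCore (𝓡 n) M).baseSet
  isOpen_baseSet := (tangentBundleCore (𝓡 n) M).isOpen_baseSet
  indexAt := (tangentBundleCore (𝓡 n) M).indexAt
  mem_baseSet_at := (tangentBundleCore (𝓡 n) M).mem_baseSet_at
  coordChange i j x := symPullback ((tangentBundleCore (𝓡 n) M).coordChange j i x)
  coordChange_self i x hx B := by
    refine symForms_ext fun v w => ?_
    simp only [formEval_symPullback]
    rw [(tangentBundleCore (𝓡 n) M).coordChange_self i x hx,
      (tangentBundleCore (𝓡 n) M).coordChange_self i x hx]
  continuousOn_coordChange i j := by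
    refine (contDiff_symPullback (n := n)).continuous.comp_continuousOn ?_
    rw [Set.inter_comm]
    exact (tangentBundleCore (𝓡 n) M).continuousOn_coordChange j i
  coordChange_comp i j k x hx B := by
    refine symForms_ext fun v w => ?_
    simp only [formEval_symPullback]
    rw [(tangentBundleCore (𝓡 n) M).coordChange_comp k j i x ⟨⟨hx.2, hx.1.2⟩, hx.1.1⟩,
      (tangentBundleCore (𝓡 n) M).coordChange_comp k j i x ⟨⟨hx.2, hx.1.2⟩, hx.1.1⟩]

instance symCore_isContMDiff : (symCore n M).IsContMDiff (𝓡 n) ∞ where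
  contMDiffOn_coordChange i j := by
    have : IsManifold (𝓡 n) (∞ + 1) M := ‹IsManifold (𝓡 n) ∞ M›
    have h : (tangentBundleCore (𝓡 n) M).IsContMDiff (𝓡 n) ∞ := tangentBundleCore.isContMDiff
    refine (contDiff_symPullback (n := n)).contMDiff.comp_contMDiffOn ?_
    change ContMDiffOn _ _ _ _ (i.1.source ∩ j.1.source)
    rw [Set.inter_comm]
    exact h.contMDiffOn_coordChange j i

variable (n M) in
/-- The total space of the smooth vector bundle `Sym² T*M` over `M`. -/
abbrev SymBundle : Type _ := Bundle.TotalSpace (symForms n) (symCore n M).Fiber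

/-- The value `σ(v, w)` of a symmetric 2-tensor at `x` on tangent vectors `v, w ∈ T_xM`. -/
def tensorEval {x : M} (σ : (symCore n M).Fiber x) (v w : TangentSpace (𝓡 n) x) : ℝ :=
  formEval (n := n) σ v w

theorem isOpen_setOf_posDefForm :
    IsOpen {B : symForms n | ∀ v : EuclideanSpace ℝ (Fin n), v ≠ 0 → 0 < formEval B v v} := by
  have hcont : Continuous fun p : symForms n × EuclideanSpace ℝ (Fin n) =>
      formEval p.1 p.2 p.2 := by
    refine continuous_finsetSum _ fun i _ => continuous_finsetSum _ fun j _ => ?_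
    have h : Continuous fun p : symForms n × EuclideanSpace ℝ (Fin n) => p.1.1 i j :=
      (continuous_apply_apply i j).comp (continuous_subtype_val.comp continuous_fst)
    have h2 (k : Fin n) : Continuous fun p : symForms n × EuclideanSpace ℝ (Fin n) => p.2 k :=
      (EuclideanSpace.proj (𝕜 := ℝ) k).continuous.comp continuous_snd
    exact h.mul ((h2 i).mul (h2 j))
  have hset : {B : symForms n | ∀ v : EuclideanSpace ℝ (Fin n), v ≠ 0 → 0 < formEval B v v} =
      {B | ∀ v ∈ Metric.sphere (0 : EuclideanSpace ℝ (Fin n)) 1, 0 < formEval B v v} := by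
    ext B
    constructor
    · intro h v hv
      exact h v (ne_zero_of_mem_unit_sphere ⟨v, hv⟩)
    · intro h v hv
      have h1 := h (‖v‖⁻¹ • v) (by simp [norm_smul, hv])
      have h2 : formEval B (‖v‖⁻¹ • v) (‖v‖⁻¹ • v) = (‖v‖⁻¹ * ‖v‖⁻¹) * formEval B v v := by
        simp only [formEval, PiLp.smul_apply, smul_eq_mul, Finset.mul_sum]
        refine Finset.sum_congr rfl fun i _ => Finset.sum_congr rfl fun j _ => ?_
        ring
      rw [h2] at h1
      exact pos_of_mul_pos_right h1 (by positivity)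
  rw [hset, isOpen_iff_mem_nhds]
  intro B hB
  exact (isCompact_sphere _ _).eventually_forall_of_forall_eventually fun v hv =>
    (hcont.continuousAt (x := (B, v))).eventually (lt_mem_nhds (hB v hv))

theorem isOpen_setOf_posDef :
    IsOpen {p : SymBundle n M | ∀ v : TangentSpace (𝓡 n) p.1, v ≠ 0 → 0 < tensorEval p.2 v v} := by
  rw [isOpen_iff_mem_nhds]
  intro p hp
  let e := (symCore n M).localTrivAt p.1
  have hp' : p ∈ e.source := FiberBundle.mem_trivializationAt_proj_source
  have hcont : ContinuousAt (fun q => (e q).2) p := continuousAt_snd.comp (e.continuousAt hp')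
  have hpe : (e p).2 = p.2 := by rw [(symCore n M).localTrivAt_apply]
  have h0 : (e p).2 ∈ {B : symForms n |
      ∀ v : EuclideanSpace ℝ (Fin n), v ≠ 0 → 0 < formEval B v v} := by
    rw [hpe]
    exact hp
  filter_upwards [hcont.preimage_mem_nhds (isOpen_setOf_posDefForm.mem_nhds h0),
    e.open_source.mem_nhds hp'] with q h1 h2 v hv
  have hq : q.1 ∈ (tangentBundleCore (𝓡 n) M).baseSet
      ((tangentBundleCore (𝓡 n) M).indexAt p.1) := e.mem_source.1 h2
  have hqq := (tangentBundleCore (𝓡 n) M).mem_baseSet_at q.1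
  let w : EuclideanSpace ℝ (Fin n) := (tangentBundleCore (𝓡 n) M).coordChange
    ((tangentBundleCore (𝓡 n) M).indexAt q.1) ((tangentBundleCore (𝓡 n) M).indexAt p.1) q.1 v
  have hw : (tangentBundleCore (𝓡 n) M).coordChange
      ((tangentBundleCore (𝓡 n) M).indexAt p.1)
      ((tangentBundleCore (𝓡 n) M).indexAt q.1) q.1 w = v :=
    ((tangentBundleCore (𝓡 n) M).coordChange_comp _ _ _ _ ⟨⟨hqq, hq⟩, hqq⟩ v).trans
      ((tangentBundleCore (𝓡 n) M).coordChange_self _ _ hqq v)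
  have hw0 : w ≠ 0 := by
    intro h
    apply hv
    rw [← hw, h, map_zero]
    rfl
  have h3 : 0 < formEval (symPullback ((tangentBundleCore (𝓡 n) M).coordChange
      ((tangentBundleCore (𝓡 n) M).indexAt p.1)
      ((tangentBundleCore (𝓡 n) M).indexAt q.1) q.1) q.2) w w := h1 w hw0
  have h4 := h3.trans_eq (formEval_symPullback _ _ _ _)
  exact h4.trans_eq (congrArg (fun x => formEval (n := n) q.2 x x) hw)

variable (n M) in
/-- `Sym⁺M`, the open submanifold of `Sym² T*M` of positive definite tensors. -/
def SymPlus : TopologicalSpace.Opens (SymBundle n M) :=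
  ⟨{p | ∀ v : TangentSpace (𝓡 n) p.1, v ≠ 0 → 0 < tensorEval p.2 v v}, isOpen_setOf_posDef⟩

variable (n) in
/-- The model with corners (without boundary) of `Sym⁺M`. -/
abbrev symModel := (𝓡 n).prod 𝓘(ℝ, symForms n)

/-- The projection `q : Sym⁺M → M`. -/
def symProj (σ : SymPlus n M) : M := σ.1.1

/-- The bilinear form `(v, w) ↦ ⟨u⁻¹ v, u⁻¹ w⟩`. -/
def frameForm (u : EuclideanSpace ℝ (Fin n) →L[ℝ] EuclideanSpace ℝ (Fin n)) : symForms n :=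
  ⟨fun i j => inner ℝ (u.inverse (EuclideanSpace.single i 1))
    (u.inverse (EuclideanSpace.single j 1)), fun _ _ => real_inner_comm _ _⟩

theorem formEval_frameForm (u : EuclideanSpace ℝ (Fin n) →L[ℝ] EuclideanSpace ℝ (Fin n))
    (v w : EuclideanSpace ℝ (Fin n)) :
    formEval (frameForm u) v w = inner ℝ (u.inverse v) (u.inverse w) := by
  conv_rhs => rw [eq_sum_single v, eq_sum_single w]
  simp only [map_sum, map_smul, sum_inner, inner_sum, real_inner_smul_left, real_inner_smul_right]
  rw [Finset.sum_comm]
  refine Finset.sum_congr rfl fun i _ => Finset.sum_congr rfl fun j _ => ?_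
  change inner ℝ _ _ * (v i * w j) = _
  ring

theorem frameForm_posDef {u : EuclideanSpace ℝ (Fin n) →L[ℝ] EuclideanSpace ℝ (Fin n)}
    (hu : u.IsInvertible) (v : EuclideanSpace ℝ (Fin n)) (hv : v ≠ 0) :
    0 < formEval (frameForm u) v v := by
  rw [formEval_frameForm]
  refine real_inner_self_pos.2 fun h => hv ?_
  rw [← hu.self_apply_inverse v, h, map_zero]

/-- The map `Σ : FM → Sym⁺M`, `Σ(u)(v, w) = ⟨u⁻¹ v, u⁻¹ w⟩`. -/
def frameToSym (u : FrameBundle n M) : SymPlus n M :=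
  ⟨⟨u.1.1, frameForm u.1.2⟩, frameForm_posDef u.2⟩

/-- The defining formula of `Σ`. -/
theorem tensorEval_frameToSym (u : FrameBundle n M) (v w : TangentSpace (𝓡 n) u.1.1) :
    tensorEval (frameToSym u).1.2 v w =
      inner ℝ (E := EuclideanSpace ℝ (Fin n)) (u.1.2.inverse v) (u.1.2.inverse w) :=
  formEval_frameForm _ _ _

/-- The factorization `π = q ∘ Σ`. -/
theorem symProj_frameToSym (u : FrameBundle n M) : symProj (frameToSym u) = frameProj u := rfl

/-! ### The maps `π`, `q` and `Σ` are smooth -/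

theorem contMDiff_frameProj : ContMDiff (frameModel n) (𝓡 n) ∞ (frameProj (n := n) (M := M)) :=
  (Bundle.contMDiff_proj _).comp contMDiff_subtype_val

theorem contMDiff_symProj : ContMDiff (symModel n) (𝓡 n) ∞ (symProj (n := n) (M := M)) :=
  (Bundle.contMDiff_proj _).comp contMDiff_subtype_val

theorem contDiffAt_frameForm {u : EuclideanSpace ℝ (Fin n) →L[ℝ] EuclideanSpace ℝ (Fin n)}
    (hu : u.IsInvertible) : ContDiffAt ℝ ∞ (frameForm (n := n)) u := by
  obtain ⟨g, hg⟩ := (symForms n).subtype.exists_leftInverse_of_injective (symForms n).ker_subtype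
  have h : (frameForm (n := n)) =
      fun L => g.toContinuousLinearMap ((symForms n).subtype (frameForm L)) := by
    funext L
    exact (LinearMap.congr_fun hg _).symm
  rw [h]
  refine g.toContinuousLinearMap.contDiff.contDiffAt.comp u ?_
  rw [contDiffAt_pi]
  intro i
  rw [contDiffAt_pi]
  intro j
  change ContDiffAt ℝ ∞ (fun L : EuclideanSpace ℝ (Fin n) →L[ℝ] EuclideanSpace ℝ (Fin n) =>
    inner ℝ (L.inverse (EuclideanSpace.single i 1)) (L.inverse (EuclideanSpace.single j 1))) u
  have h := hu.contDiffAt_map_inverse (n := ∞)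
  exact (h.clm_apply contDiffAt_const).inner ℝ (h.clm_apply contDiffAt_const)

theorem contMDiff_frameToSym : ContMDiff (frameModel n) (symModel n) ∞ (frameToSym (n := n) (M := M)) := by
  rw [← ContMDiff.subtypeVal_comp_iff]
  intro u
  rw [Bundle.contMDiffAt_totalSpace]
  refine ⟨contMDiff_frameProj u, ?_⟩
  let E := EuclideanSpace ℝ (Fin n)
  let e := trivializationAt (E →L[ℝ] E)
    (fun x : M => Bundle.Trivial M E x →L[ℝ] TangentSpace (𝓡 n) x) u.1.1
  have h1 : ContMDiffAt (frameModel n) 𝓘(ℝ, E →L[ℝ] E) ∞ (fun p : FrameBundle n M => (e p.1).2) u := by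
    have := (Bundle.contMDiffAt_totalSpace (n := ∞) (IB := 𝓡 n) (IM := frameModel n)
      (F := E →L[ℝ] E) (E := (fun x : M => Bundle.Trivial M E x →L[ℝ] TangentSpace (𝓡 n) x))
      (f := (Subtype.val : FrameBundle n M → HomBundle n M)) (x₀ := u)).1 contMDiff_subtype_val.contMDiffAt
    exact this.2
  have hu : (e u.1).2.IsInvertible := by
    have hq' := e.mem_source.1 (FiberBundle.mem_trivializationAt_proj_source (x := u.1))
    change (ContinuousLinearMap.inCoordinates E (Bundle.Trivial M E) E (TangentSpace (𝓡 n))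
      u.1.1 u.1.1 u.1.1 u.1.1 u.1.2).IsInvertible
    rw [ContinuousLinearMap.inCoordinates_eq hq'.1 hq'.2]
    simp only [ContinuousLinearMap.isInvertible_equiv_comp, ContinuousLinearMap.isInvertible_comp_equiv]
    exact u.2
  have h2 := (contDiffAt_frameForm hu).contMDiffAt.comp u h1
  refine h2.congr_of_eventuallyEq ?_
  have hev : ∀ᶠ p : FrameBundle n M in nhds u, p.1 ∈ e.source :=
    continuous_subtype_val.continuousAt (e.open_source.mem_nhds FiberBundle.mem_trivializationAt_proj_source)
  filter_upwards [hev] with p hp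
  have hq' := e.mem_source.1 hp
  apply symForms_ext
  intro v w
  have hq : p.1.1 ∈ (tangentBundleCore (𝓡 n) M).baseSet
      ((tangentBundleCore (𝓡 n) M).indexAt u.1.1) := hq'.2
  let C := (tangentBundleCore (𝓡 n) M).coordChange
    ((tangentBundleCore (𝓡 n) M).indexAt u.1.1)
      ((tangentBundleCore (𝓡 n) M).indexAt p.1.1) p.1.1
  let D := (tangentBundleCore (𝓡 n) M).coordChange
    ((tangentBundleCore (𝓡 n) M).indexAt p.1.1)
      ((tangentBundleCore (𝓡 n) M).indexAt u.1.1) p.1.1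
  let A : E →L[ℝ] E := p.1.2
  have hA : A.IsInvertible := p.2
  have hqq := (tangentBundleCore (𝓡 n) M).mem_baseSet_at p.1.1
  have hDC : ∀ v, D (C v) = v := fun v =>
    ((tangentBundleCore (𝓡 n) M).coordChange_comp _ _ _ _ ⟨⟨hq, hqq⟩, hq⟩ v).trans
      ((tangentBundleCore (𝓡 n) M).coordChange_self _ _ hq v)
  have hCD : ∀ v, C (D v) = v := fun v =>
    ((tangentBundleCore (𝓡 n) M).coordChange_comp _ _ _ _ ⟨⟨hqq, hq⟩, hqq⟩ v).trans
      ((tangentBundleCore (𝓡 n) M).coordChange_self _ _ hqq v)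
  have hD : D.IsInvertible := ⟨ContinuousLinearEquiv.equivOfInverse D C hCD hDC, rfl⟩
  have hlhs : formEval (n := n) (symPullback C (frameForm A)) v w = inner ℝ (A.inverse (C v)) (A.inverse (C w)) := by
    rw [formEval_symPullback, formEval_frameForm]
  have hin : ContinuousLinearMap.inCoordinates E (Bundle.Trivial M E) E (TangentSpace (𝓡 n))
      u.1.1 p.1.1 u.1.1 p.1.1 p.1.2 = D ∘L A := by
    rw [ContinuousLinearMap.inCoordinates]
    erw [TangentBundle.continuousLinearMapAt_trivializationAt_eq_core hq]
    ext1 x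
    simp
    rfl
  have hr : ∀ v, (D ∘L A).inverse v = A.inverse (C v) := by
    intro v
    rw [(hD.comp hA).inverse_apply_eq]
    simp [hA.self_apply_inverse, hDC]
  refine Eq.trans hlhs ?_
  change _ = formEval (n := n) (frameForm (ContinuousLinearMap.inCoordinates E (Bundle.Trivial M E) E (TangentSpace (𝓡 n))
      u.1.1 p.1.1 u.1.1 p.1.1 p.1.2)) v w
  rw [hin, formEval_frameForm, hr, hr]

end

end FrameSym

/-! Every positive definite form is the form of a frame, because its matrix factors as `CᵀC`; so `Σ`
is surjective. Two frames with the same form differ by a linear isometry `a`, and `Σ ∘ R_a = Σ` for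
such `a`. Differentiating this identity and using the invariance of `𝓗` shows that `Σ_* 𝓗_u` depends
only on `Σ(u)` (`IsPrincipalConnection.heq_map_mfderiv_frameToSym`). Hence the image condition
defines a distribution on all of `Sym⁺M` and leaves no choice for it.

That this distribution is a complement of `ker q_*` is linear algebra from `π_* = q_* ∘ Σ_*`
(`isCompl_map_ker`); the same factorization makes `Σ_*` injective on `𝓗`. Horizontal lifts exist
uniquely because `q_*` is surjective.

Smoothness rests on smooth local sections of `Σ` through every frame
(`exists_localSection_frameToSym`). They come from the inverse function theorem applied to `S ↦ ⟨(1
+ S)·, (1 + S)·⟩` at `S = 0`. Pushing a local frame of `𝓗` forward along a section gives a local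
frame of the image (`IsSmoothDistribution.of_map_eq`). The vertical bundle is smooth because `q` is
a coordinate projection in charts (`IsFstInCharts`). -/

namespace FrameSym

noncomputable section

/-! ### Gram forms of endomorphisms of `ℝⁿ` -/

section Model

variable {n : ℕ}

/-- The form `(v, w) ↦ ⟨T v, T w⟩`. -/
def gramForm (T : EuclideanSpace ℝ (Fin n) →L[ℝ] EuclideanSpace ℝ (Fin n)) : symForms n :=
  ⟨fun i j => inner ℝ (T (EuclideanSpace.single i 1)) (T (EuclideanSpace.single j 1)),
    fun _ _ => real_inner_comm _ _⟩

theorem formEval_gramForm (T : EuclideanSpace ℝ (Fin n) →L[ℝ] EuclideanSpace ℝ (Fin n))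
    (v w : EuclideanSpace ℝ (Fin n)) :
    formEval (gramForm T) v w = inner ℝ (T v) (T w) := by
  conv_rhs => rw [eq_sum_single v, eq_sum_single w]
  simp only [map_sum, map_smul, sum_inner, inner_sum, real_inner_smul_left, real_inner_smul_right]
  rw [Finset.sum_comm]
  refine Finset.sum_congr rfl fun i _ => Finset.sum_congr rfl fun j _ => ?_
  change inner ℝ _ _ * (v i * w j) = _
  ring

theorem frameForm_eq_gramForm (A : EuclideanSpace ℝ (Fin n) →L[ℝ] EuclideanSpace ℝ (Fin n)) :
    frameForm A = gramForm A.inverse := rfl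

/-- Analyticity matters later: unlike smoothness of order `∞` at a point, it spreads to a
neighbourhood, and the inverse function theorem preserves it. -/
theorem contDiff_gramForm : ContDiff ℝ ω (gramForm (n := n)) := by
  -- A linear retraction onto the symmetric forms reduces the claim to the matrix entries.
  obtain ⟨g, hg⟩ := (symForms n).subtype.exists_leftInverse_of_injective (symForms n).ker_subtype
  have h : gramForm (n := n) =
      fun L => g.toContinuousLinearMap ((symForms n).subtype (gramForm L)) := by
    funext L
    exact (LinearMap.congr_fun hg (gramForm L)).symm
  rw [h]
  refine g.toContinuousLinearMap.contDiff.comp ?_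
  rw [contDiff_pi]
  intro i
  rw [contDiff_pi]
  intro j
  change ContDiff ℝ ω fun L : EuclideanSpace ℝ (Fin n) →L[ℝ] EuclideanSpace ℝ (Fin n) =>
    inner ℝ (L (EuclideanSpace.single i 1)) (L (EuclideanSpace.single j 1))
  exact (contDiff_id.clm_apply contDiff_const).inner ℝ (contDiff_id.clm_apply contDiff_const)

theorem symPullback_gramForm (L T : EuclideanSpace ℝ (Fin n) →L[ℝ] EuclideanSpace ℝ (Fin n)) :
    symPullback L (gramForm T) = gramForm (T ∘L L) :=
  symForms_ext fun v w => by simp [formEval_symPullback, formEval_gramForm]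

theorem symPullback_symPullback (L T : EuclideanSpace ℝ (Fin n) →L[ℝ] EuclideanSpace ℝ (Fin n))
    (B : symForms n) : symPullback L (symPullback T B) = symPullback (T ∘L L) B :=
  symForms_ext fun v w => by simp [formEval_symPullback]

theorem symPullback_id (B : symForms n) :
    symPullback (ContinuousLinearMap.id ℝ (EuclideanSpace ℝ (Fin n))) B = B :=
  symForms_ext fun v w => by simp [formEval_symPullback]

theorem formEval_add (A B : symForms n) (v w : EuclideanSpace ℝ (Fin n)) :
    formEval (A + B) v w = formEval A v w + formEval B v w := by
  simp [formEval, add_mul, Finset.sum_add_distrib]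

theorem formEval_smul (c : ℝ) (B : symForms n) (v w : EuclideanSpace ℝ (Fin n)) :
    formEval (c • B) v w = c * formEval B v w := by
  simp [formEval, mul_assoc, Finset.mul_sum]

/-- The self-adjoint operator of a symmetric bilinear form. -/
def symOp : symForms n →L[ℝ] (EuclideanSpace ℝ (Fin n) →L[ℝ] EuclideanSpace ℝ (Fin n)) :=
  LinearMap.toContinuousLinearMap
    { toFun S := Matrix.toEuclideanCLM (𝕜 := ℝ) (Matrix.of S.1)
      map_add' A B := by
        rw [← map_add]
        rfl
      map_smul' c B := by
        rw [RingHom.id_apply, ← map_smul]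
        rfl }

theorem inner_symOp (S : symForms n) (v w : EuclideanSpace ℝ (Fin n)) :
    inner ℝ (symOp S v) w = formEval S v w := by
  have h : ∀ i, (symOp S v) i = ∑ j, S.1 i j * v j := fun i => rfl
  rw [formEval_symm]
  simp only [PiLp.inner_apply, h, formEval, RCLike.inner_apply, conj_trivial, Finset.mul_sum]
  refine Finset.sum_congr rfl fun i _ => Finset.sum_congr rfl fun j _ => ?_
  ring

/-- Self-adjointness makes the two cross terms equal, hence the factor 2. The linear term is the
derivative needed for the inverse function theorem. -/
theorem gramForm_id_add_symOp (S : symForms n) (t : ℝ) :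
    gramForm (ContinuousLinearMap.id ℝ _ + symOp (t • S)) =
      gramForm (ContinuousLinearMap.id ℝ _) + t • ((2 : ℝ) • S) +
        t ^ 2 • gramForm (symOp S) := by
  refine symForms_ext fun v w => ?_
  simp only [formEval_add, formEval_smul, formEval_gramForm, map_smul,
    add_apply, ContinuousLinearMap.id_apply, smul_apply,
    inner_add_left, inner_add_right, real_inner_smul_left, real_inner_smul_right, inner_symOp]
  rw [real_inner_comm (symOp S w) v, inner_symOp, formEval_symm S w v]
  ring

theorem isInvertible_of_forall_apply_eq_zero
    {T : EuclideanSpace ℝ (Fin n) →L[ℝ] EuclideanSpace ℝ (Fin n)} (h : ∀ v, T v = 0 → v = 0) :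
    T.IsInvertible :=
  ⟨(LinearEquiv.ofInjectiveEndo T.toLinearMap
    ((injective_iff_map_eq_zero T.toLinearMap).2 h)).toContinuousLinearEquiv, by ext1 v; rfl⟩

theorem inverse_inverse {T : EuclideanSpace ℝ (Fin n) →L[ℝ] EuclideanSpace ℝ (Fin n)}
    (hT : T.IsInvertible) : T.inverse.inverse = T := by
  obtain ⟨e, rfl⟩ := hT
  simp

theorem frameForm_comp_isometry
    {C : EuclideanSpace ℝ (Fin n) →L[ℝ] EuclideanSpace ℝ (Fin n)} (hC : C.IsInvertible)
    {a : EuclideanSpace ℝ (Fin n) ≃L[ℝ] EuclideanSpace ℝ (Fin n)}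
    (ha : ∀ v w, inner ℝ (a v) (a w) = inner ℝ v w) :
    frameForm (C ∘L a.toContinuousLinearMap) = frameForm C := by
  obtain ⟨c, rfl⟩ := hC
  refine symForms_ext fun v w => ?_
  have h1 : ∀ v, (c.toContinuousLinearMap ∘L a.toContinuousLinearMap).inverse v =
      a.symm (c.symm v) :=
    fun v => congrArg (fun L => L v) (ContinuousLinearMap.inverse_equiv (a.trans c))
  rw [formEval_frameForm, formEval_frameForm, h1, h1, ← ha]
  simp

/-- Take `a = A⁻¹A'`; it is an isometry by evaluating the equality of forms on `A'v` and `A'w`. -/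
theorem exists_isometry_of_frameForm_eq
    {A A' : EuclideanSpace ℝ (Fin n) →L[ℝ] EuclideanSpace ℝ (Fin n)}
    (hA : A.IsInvertible) (hA' : A'.IsInvertible) (h : frameForm A = frameForm A') :
    ∃ a : EuclideanSpace ℝ (Fin n) ≃L[ℝ] EuclideanSpace ℝ (Fin n),
      A ∘L a.toContinuousLinearMap = A' ∧ ∀ v w, inner ℝ (a v) (a w) = inner ℝ v w := by
  obtain ⟨b, rfl⟩ := hA
  obtain ⟨b', rfl⟩ := hA'
  refine ⟨b'.trans b.symm, by ext1 v; simp, fun v w => ?_⟩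
  have h1 := congrArg (fun B => formEval B (b' v) (b' w)) h
  simp only [formEval_frameForm] at h1
  rw [ContinuousLinearMap.inverse_equiv, ContinuousLinearMap.inverse_equiv] at h1
  simpa using h1

/-! ### Frames to forms: surjectivity and local sections. -/

open scoped MatrixOrder in
/-- Every positive definite form is the form of some frame. -/
theorem exists_frameForm_eq (B : symForms n)
    (hB : ∀ v : EuclideanSpace ℝ (Fin n), v ≠ 0 → 0 < formEval B v v) :
    ∃ A : EuclideanSpace ℝ (Fin n) →L[ℝ] EuclideanSpace ℝ (Fin n),
      A.IsInvertible ∧ frameForm A = B := by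
  have hps : (Matrix.of B.1).PosSemidef := by
    refine .of_dotProduct_mulVec_nonneg (by ext i j; exact B.2 j i) fun x => ?_
    have h : star x ⬝ᵥ (Matrix.of B.1).mulVec x = formEval B (WithLp.toLp 2 x) (WithLp.toLp 2 x) := by
      simp only [dotProduct, Matrix.mulVec, formEval, Finset.mul_sum, Matrix.of_apply,
        Pi.star_apply, star_trivial]
      refine Finset.sum_congr rfl fun i _ => Finset.sum_congr rfl fun j _ => ?_
      ring
    rw [h]
    by_cases hx : (WithLp.toLp 2 x : EuclideanSpace ℝ (Fin n)) = 0
    · rw [hx]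
      simp [formEval]
    · exact (hB _ hx).le
  -- With `B = CᵀC` the form is the Gram form of `C`, so the frame sought is `C⁻¹`; `C` is injective
  -- because `B` is positive on nonzero vectors.
  obtain ⟨C, hC⟩ := CStarAlgebra.nonneg_iff_eq_star_mul_self.1 hps.nonneg
  let T : EuclideanSpace ℝ (Fin n) →L[ℝ] EuclideanSpace ℝ (Fin n) :=
    Matrix.toEuclideanCLM (𝕜 := ℝ) C
  have hT : gramForm T = B := by
    ext i j
    have h1 : ∀ i k, (T (EuclideanSpace.single i 1)) k = C k i := by
      intro i k
      change ((Matrix.toEuclideanCLM (𝕜 := ℝ) C) (EuclideanSpace.single i 1)) k = _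
      rw [Matrix.ofLp_toEuclideanCLM]
      simp
    have h2 : B.1 i j = (C.conjTranspose * C) i j := by
      rw [← Matrix.star_eq_conjTranspose, ← hC]
      rfl
    rw [h2]
    change inner ℝ (T (EuclideanSpace.single i 1)) (T (EuclideanSpace.single j 1)) = _
    simp only [PiLp.inner_apply, h1, RCLike.inner_apply, conj_trivial, Matrix.mul_apply,
      Matrix.conjTranspose_apply, star_trivial]
    exact Finset.sum_congr rfl fun k _ => mul_comm _ _
  have hinv : T.IsInvertible := by
    refine isInvertible_of_forall_apply_eq_zero fun v hv => ?_
    by_contra h0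
    have := hB v h0
    rw [← hT, formEval_gramForm, hv, inner_zero_left] at this
    exact this.false
  refine ⟨T.inverse, hinv.inverse, ?_⟩
  rw [frameForm_eq_gramForm, inverse_inverse hinv, hT]

/-- The map sending a frame to its form has smooth local sections through every frame. -/
theorem exists_localSection_frameForm
    {A : EuclideanSpace ℝ (Fin n) →L[ℝ] EuclideanSpace ℝ (Fin n)} (hA : A.IsInvertible) :
    ∃ h : symForms n → (EuclideanSpace ℝ (Fin n) →L[ℝ] EuclideanSpace ℝ (Fin n)),
      h (frameForm A) = A ∧
      (∀ᶠ B in nhds (frameForm A), ContDiffAt ℝ ∞ h B) ∧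
      ∀ᶠ B in nhds (frameForm A), frameForm (h B) = B := by
  -- Moving only along self-adjoint `S` removes the isometry ambiguity, so source and target have
  -- the same dimension and `f` can be inverted near `0`.
  let T : symForms n → (EuclideanSpace ℝ (Fin n) →L[ℝ] EuclideanSpace ℝ (Fin n)) :=
    fun S => ContinuousLinearMap.id ℝ _ + symOp S
  let f : symForms n → symForms n := fun S => symPullback A.inverse (gramForm (T S))
  have hT : ContDiff ℝ ω T := contDiff_const.add symOp.contDiff
  have hT0 : T 0 = ContinuousLinearMap.id ℝ _ := by simp [T]
  have hf : ContDiff ℝ ω f :=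
    (symPullback A.inverse).contDiff.comp (contDiff_gramForm.comp hT)
  have hf0 : f 0 = frameForm A := by
    simp only [f, hT0, symPullback_gramForm, frameForm_eq_gramForm, ContinuousLinearMap.id_comp]
  have hAA : A ∘L A.inverse = ContinuousLinearMap.id ℝ _ := by
    ext1 v; exact hA.self_apply_inverse v
  have hAA' : A.inverse ∘L A = ContinuousLinearMap.id ℝ _ := by
    ext1 v; exact hA.inverse_apply_self v
  let f' : symForms n ≃L[ℝ] symForms n := ContinuousLinearEquiv.equivOfInverse
    ((2 : ℝ) • symPullback A.inverse) ((2⁻¹ : ℝ) • symPullback A)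
    (fun B => by simp [symPullback_symPullback, hAA', symPullback_id])
    (fun B => by simp [symPullback_symPullback, hAA, symPullback_id])
  have hf' : HasFDerivAt f (f' : symForms n →L[ℝ] symForms n) 0 := by
    have hd : HasFDerivAt f (fderiv ℝ f 0) 0 :=
      (hf.differentiable (by simp) 0).hasFDerivAt
    have he : fderiv ℝ f 0 = f' := by
      ext1 S
      -- The derivative is identified along each line `t ↦ t • S`, where `f` is an explicit
      -- quadratic polynomial in `t`.
      have h1 : HasDerivAt (fun t : ℝ => f (t • S)) (fderiv ℝ f 0 S) 0 := by
        have h2 : HasDerivAt (fun t : ℝ => t • S) S 0 := by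
          simpa using (hasDerivAt_id (0 : ℝ)).smul_const S
        have hd' : HasFDerivAt f (fderiv ℝ f 0) ((0 : ℝ) • S) := by rwa [zero_smul]
        exact HasFDerivAt.comp_hasDerivAt (f := fun t : ℝ => t • S) (0 : ℝ) hd' h2
      have h3 : HasDerivAt (fun t : ℝ => f (t • S)) (f' S) 0 := by
        have h4 : (fun t : ℝ => f (t • S)) = fun t : ℝ => f 0 + t • f' S +
            t ^ 2 • symPullback A.inverse (gramForm (symOp S)) := by
          funext t
          have h6 : f (t • S) = symPullback A.inverse (gramForm (ContinuousLinearMap.id ℝ _) +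
              t • ((2 : ℝ) • S) + t ^ 2 • gramForm (symOp S)) :=
            congrArg (symPullback A.inverse) (gramForm_id_add_symOp S t)
          rw [h6, map_add, map_add, map_smul, map_smul _ (t ^ 2), map_smul, ← hT0]
          rfl
        rw [h4]
        have h5 := (((hasDerivAt_id (0 : ℝ)).smul_const (f' S)).const_add (f 0)).add
          ((hasDerivAt_pow 2 (0 : ℝ)).smul_const (symPullback A.inverse (gramForm (symOp S))))
        exact h5.congr_deriv (by simp)
      exact h1.unique h3
    rwa [he] at hd
  have hω : (ω : WithTop ℕ∞) ≠ 0 := by simp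
  let g := hf.contDiffAt.localInverse hf' hω
  have hg : ContDiffAt ℝ ω g (f 0) := hf.contDiffAt.to_localInverse hf' hω
  have hg0 : g (f 0) = 0 := hf.contDiffAt.localInverse_apply_image hf' hω
  have hfg : ∀ᶠ B in nhds (f 0), f (g B) = B :=
    (hf.contDiffAt.hasStrictFDerivAt' hf' hω).eventually_right_inverse
  have hTg : ContDiffAt ℝ ω (fun B => T (g B)) (f 0) := hT.contDiffAt.comp _ hg
  have hTg0 : (T (g (f 0))).IsInvertible := by
    rw [hg0, hT0]
    exact ⟨ContinuousLinearEquiv.refl ℝ _, rfl⟩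
  have hTinv : ∀ᶠ B in nhds (f 0), (T (g B)).IsInvertible :=
    hTg.continuousAt.eventually
      ((ContinuousLinearEquiv.isOpen (𝕜 := ℝ) (E := EuclideanSpace ℝ (Fin n))
        (F := EuclideanSpace ℝ (Fin n))).mem_nhds hTg0)
  -- The inverse of this frame is `T (g B) ∘ A⁻¹`, whose Gram form is `f (g B) = B`.
  refine ⟨fun B => A ∘L (T (g B)).inverse, ?_, ?_, ?_⟩
  · rw [← hf0]
    change A ∘L (T (g (f 0))).inverse = A
    rw [hg0, hT0, ContinuousLinearMap.inverse_id, ContinuousLinearMap.comp_id]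
  · rw [← hf0]
    have h5 : ContDiffAt ℝ ω (fun B => (T (g B)).inverse) (f 0) :=
      ContDiffAt.comp (f 0) (g := ContinuousLinearMap.inverse) hTg0.contDiffAt_map_inverse hTg
    have h : ContDiffAt ℝ ω (fun B => A ∘L (T (g B)).inverse) (f 0) :=
      contDiffAt_const.clm_comp h5
    exact (h.eventually (by simp)).mono fun B hB => hB.of_le le_top
  · rw [← hf0]
    filter_upwards [hfg, hTinv] with B h1 h2
    have h3 : (A ∘L (T (g B)).inverse).inverse = T (g B) ∘L A.inverse := by
      obtain ⟨a, rfl⟩ := hA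
      obtain ⟨b, hb⟩ := h2
      rw [← hb]
      simp only [ContinuousLinearMap.inverse_equiv]
      exact ContinuousLinearMap.inverse_equiv (b.symm.trans a)
    rw [frameForm_eq_gramForm, h3, ← symPullback_gramForm]
    exact h1

end Model

/-! ### Maps that are coordinate projections in charts. -/

section
variable {E F H H' M N : Type*} [NormedAddCommGroup E] [NormedSpace ℝ E]
  [NormedAddCommGroup F] [NormedSpace ℝ F]
  [TopologicalSpace H] {I : ModelWithCorners ℝ E H}
  [TopologicalSpace H'] {J : ModelWithCorners ℝ (E × F) H'}
  [TopologicalSpace M] [ChartedSpace H M] [IsManifold I ∞ M]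
  [TopologicalSpace N] [ChartedSpace H' N] [IsManifold J ∞ N]

/-- `f` is the first projection in the preferred charts at `p` and `f p`, for every `p`. -/
structure IsFstInCharts (I : ModelWithCorners ℝ E H) (J : ModelWithCorners ℝ (E × F) H')
    (f : N → M) : Prop where
  contMDiff : ContMDiff J I ∞ f
  mapsTo {p q : N} : q ∈ (chartAt H' p).source → f q ∈ (chartAt H (f p)).source
  extChartAt_fst {p q : N} : q ∈ (chartAt H' p).source →
    (extChartAt J p q).1 = extChartAt I (f p) (f q)

namespace IsFstInCharts

variable {f : N → M} (hf : IsFstInCharts I J f)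
include hf

/-- Chain rule applied to `fst ∘ chart = chart ∘ f`, which holds on the whole chart domain and hence
near `q`. -/
theorem mfderiv_extChartAt_apply {p q : N} (hq : q ∈ (chartAt H' p).source) (v : TangentSpace J q) :
    mfderiv I 𝓘(ℝ, E) (extChartAt I (f p)) (f q) (mfderiv J I f q v) =
      (mfderiv J 𝓘(ℝ, E × F) (extChartAt J p) q v : E × F).1 := by
  have : IsManifold J 1 N := .of_le (n := ∞) (by simp)
  have : IsManifold I 1 M := .of_le (n := ∞) (by simp)
  have h1 : MDifferentiableAt I 𝓘(ℝ, E) (extChartAt I (f p)) (f q) :=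
    mdifferentiableAt_extChartAt (hf.mapsTo hq)
  have h2 : MDifferentiableAt J 𝓘(ℝ, E × F) (extChartAt J p) q := mdifferentiableAt_extChartAt hq
  have h3 : MDifferentiableAt J I f q := hf.contMDiff.mdifferentiableAt (by simp)
  have h4 : HasMFDerivAt 𝓘(ℝ, E × F) 𝓘(ℝ, E) (Prod.fst : E × F → E) (extChartAt J p q)
    (ContinuousLinearMap.fst ℝ E F) := hasFDerivAt_fst.hasMFDerivAt
  have h5 := h4.comp q h2.hasMFDerivAt
  have h6 := h1.hasMFDerivAt.comp q h3.hasMFDerivAt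
  have h7 : Prod.fst ∘ extChartAt J p =ᶠ[nhds q] extChartAt I (f p) ∘ f := by
    filter_upwards [(chartAt H' p).open_source.mem_nhds hq] with x hx
    exact hf.extChartAt_fst hx
  have h8 := hasMFDerivAt_unique (h6.congr_of_eventuallyEq h7) h5
  exact DFunLike.congr_fun h8 v

/-- At the centre of the preferred charts their derivatives are the identity, so the derivative of
`f` is `fst` and `(w, 0)` is a preimage of `w`. -/
theorem surjective_mfderiv (p : N) : Function.Surjective (mfderiv J I f p) := by
  have : IsManifold J 1 N := .of_le (n := ∞) (by simp)
  have : IsManifold I 1 M := .of_le (n := ∞) (by simp)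
  intro w
  have h := hf.mfderiv_extChartAt_apply (mem_chart_source H' p) ((show E from w, 0) : E × F)
  rw [mfderiv_extChartAt_self, mfderiv_extChartAt_self] at h
  exact ⟨_, h⟩

theorem mem_ker_mfderiv_iff {p q : N} (hq : q ∈ (chartAt H' p).source) (v : TangentSpace J q) :
    v ∈ (mfderiv J I f q).ker ↔
      (mfderiv J 𝓘(ℝ, E × F) (extChartAt J p) q v : E × F).1 = 0 := by
  have : IsManifold I 1 M := .of_le (n := ∞) (by simp)
  rw [← hf.mfderiv_extChartAt_apply hq]
  obtain ⟨e, he⟩ := isInvertible_mfderiv_extChartAt (I := I) (x := f p) (y := f q)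
    (by rw [extChartAt_source]; exact hf.mapsTo hq)
  rw [← he]
  exact e.map_eq_zero_iff.symm

theorem isSmoothDistribution_ker [FiniteDimensional ℝ F] :
    IsSmoothDistribution (I := J) fun p => (mfderiv J I f p).ker := by
  have : IsManifold J 1 N := .of_le (n := ∞) (by simp)
  have : IsManifold I 1 M := .of_le (n := ∞) (by simp)
  intro p
  let e := trivializationAt (E × F) (TangentSpace J) p
  let b := Module.finBasis ℝ F
  -- In the tangent trivialization at `p` the kernel is `0 × F`, so the constant sections `(0, b i)`
  -- form a local frame.
  refine ⟨Module.finrank ℝ F, (chartAt H' p).source, fun i q => e.symmL ℝ q (0, b i),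
    (chartAt H' p).open_source, mem_chart_source H' p, fun i => ?_, fun q hq => ?_⟩
  · refine (e.contMDiffOn_section_baseSet_iff (n := ∞) (s := fun q => e.symmL ℝ q (0, b i))).2
      ((contMDiffOn_const (c := ((0, b i) : E × F))).congr fun q hq => ?_)
    have h := e.apply_mk_symm hq ((0, b i) : E × F)
    rw [← e.symmL_apply (R := ℝ) hq] at h
    exact congrArg Prod.snd h
  · have he : q ∈ e.baseSet := hq
    let L : F →ₗ[ℝ] TangentSpace J q := (e.symmL ℝ q).toLinearMap ∘ₗ LinearMap.inr ℝ E F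
    have hL : ∀ y, e.continuousLinearMapAt ℝ q (L y) = (0, y) :=
      fun y => e.continuousLinearMapAt_symmL he (0, y)
    have hker : LinearMap.ker L = ⊥ := by
      rw [LinearMap.ker_eq_bot']
      intro y hy
      have := hL y
      rw [hy, map_zero] at this
      exact (congrArg Prod.snd this).symm
    refine ⟨b.linearIndependent.map' L hker, ?_⟩
    have hspan : Submodule.span ℝ (Set.range fun i => L (b i)) = LinearMap.range L := by
      rw [LinearMap.range_eq_map, ← b.span_eq, Submodule.map_span, ← Set.range_comp]
      rfl
    refine hspan.trans (Submodule.ext fun v => ?_)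
    rw [hf.mem_ker_mfderiv_iff hq, ← TangentBundle.continuousLinearMapAt_trivializationAt hq]
    constructor
    · rintro ⟨y, rfl⟩
      exact congrArg Prod.fst (hL y)
    · intro hv
      refine ⟨(e.continuousLinearMapAt ℝ q v).2, ?_⟩
      refine Eq.trans ?_ (e.symmL_continuousLinearMapAt (R := ℝ) he v)
      exact congrArg (e.symmL ℝ q) (Prod.ext hv.symm rfl)

end IsFstInCharts
end

/-! ### Charts, local sections and the group action on the frame bundle. -/

section Frames

variable {n : ℕ} {M : Type*} [TopologicalSpace M] [ChartedSpace (EuclideanSpace ℝ (Fin n)) M]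
  [IsManifold (𝓡 n) ∞ M]

theorem isFstInCharts_symProj :
    IsFstInCharts (𝓡 n) (symModel n) (symProj (n := n) (M := M)) where
  contMDiff := contMDiff_symProj
  mapsTo {p q} hq := by
    simp only [TopologicalSpace.Opens.chartAt_eq, FiberBundle.chartedSpace_chartAt] at hq
    simp at hq
    exact hq.2
  extChartAt_fst _ := rfl

theorem mem_chartAt_source_symPlus {p q : SymPlus n M}
    (h : symProj q ∈ (chartAt (EuclideanSpace ℝ (Fin n)) (symProj p)).source) :
    q ∈ (chartAt (ModelProd (EuclideanSpace ℝ (Fin n)) (symForms n)) p).source := by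
  simp only [TopologicalSpace.Opens.chartAt_eq, FiberBundle.chartedSpace_chartAt]
  simp
  exact ⟨(Bundle.Trivialization.mem_source _).2 h, h⟩

theorem isFstInCharts_frameProj :
    IsFstInCharts (𝓡 n) (frameModel n) (frameProj (n := n) (M := M)) where
  contMDiff := contMDiff_frameProj
  mapsTo {p q} hq := by
    simp only [TopologicalSpace.Opens.chartAt_eq, FiberBundle.chartedSpace_chartAt] at hq
    simp at hq
    exact hq.2
  extChartAt_fst _ := rfl

/-- In a chart of the frame bundle, a frame is composed with the change of coordinates. -/
theorem extChartAt_frameBundle_snd {u₀ u : FrameBundle n M}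
    (hu : frameProj u ∈ (chartAt (EuclideanSpace ℝ (Fin n)) (frameProj u₀)).source) :
    (extChartAt (frameModel n) u₀ u).2 =
      ((tangentBundleCore (𝓡 n) M).coordChange
        ((tangentBundleCore (𝓡 n) M).indexAt u.1.1) ((tangentBundleCore (𝓡 n) M).indexAt u₀.1.1)
        u.1.1) ∘L (u.1.2 : EuclideanSpace ℝ (Fin n) →L[ℝ] EuclideanSpace ℝ (Fin n)) := by
  let E := EuclideanSpace ℝ (Fin n)
  let D := (tangentBundleCore (𝓡 n) M).coordChange
    ((tangentBundleCore (𝓡 n) M).indexAt u.1.1) ((tangentBundleCore (𝓡 n) M).indexAt u₀.1.1) u.1.1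
  let A : E →L[ℝ] E := u.1.2
  change ContinuousLinearMap.inCoordinates E (Bundle.Trivial M E) E (TangentSpace (𝓡 n))
    u₀.1.1 u.1.1 u₀.1.1 u.1.1 u.1.2 = D ∘L A
  rw [ContinuousLinearMap.inCoordinates]
  erw [TangentBundle.continuousLinearMapAt_trivializationAt_eq_core hu]
  ext1 x
  simp
  rfl

/-- The coordinate expression of `Σ`. -/
theorem extChartAt_frameToSym {u₀ u : FrameBundle n M}
    (hu : frameProj u ∈ (chartAt (EuclideanSpace ℝ (Fin n)) (frameProj u₀)).source) :
    extChartAt (symModel n) (frameToSym u₀) (frameToSym u) =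
      ((extChartAt (frameModel n) u₀ u).1, frameForm (extChartAt (frameModel n) u₀ u).2) := by
  refine Prod.ext rfl ?_
  rw [extChartAt_frameBundle_snd hu]
  let C := (tangentBundleCore (𝓡 n) M).coordChange
    ((tangentBundleCore (𝓡 n) M).indexAt u₀.1.1) ((tangentBundleCore (𝓡 n) M).indexAt u.1.1) u.1.1
  let D := (tangentBundleCore (𝓡 n) M).coordChange
    ((tangentBundleCore (𝓡 n) M).indexAt u.1.1) ((tangentBundleCore (𝓡 n) M).indexAt u₀.1.1) u.1.1
  let A : EuclideanSpace ℝ (Fin n) →L[ℝ] EuclideanSpace ℝ (Fin n) := u.1.2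
  have hA : A.IsInvertible := u.2
  have hqq := (tangentBundleCore (𝓡 n) M).mem_baseSet_at u.1.1
  have hq : u.1.1 ∈ (tangentBundleCore (𝓡 n) M).baseSet
      ((tangentBundleCore (𝓡 n) M).indexAt u₀.1.1) := hu
  have hDC : ∀ v, D (C v) = v := fun v =>
    ((tangentBundleCore (𝓡 n) M).coordChange_comp _ _ _ _ ⟨⟨hq, hqq⟩, hq⟩ v).trans
      ((tangentBundleCore (𝓡 n) M).coordChange_self _ _ hq v)
  have hCD : ∀ v, C (D v) = v := fun v =>
    ((tangentBundleCore (𝓡 n) M).coordChange_comp _ _ _ _ ⟨⟨hqq, hq⟩, hqq⟩ v).trans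
      ((tangentBundleCore (𝓡 n) M).coordChange_self _ _ hqq v)
  -- Frames change coordinates by `D` and forms by pullback along `C = D⁻¹`; this identity makes the
  -- two compatible.
  have hr : (D ∘L A).inverse = A.inverse ∘L C := by
    obtain ⟨a, ha⟩ := hA
    rw [← ha, ContinuousLinearMap.inverse_equiv]
    exact ContinuousLinearMap.inverse_equiv
      (a.trans (ContinuousLinearEquiv.equivOfInverse D C hCD hDC))
  change symPullback C (gramForm A.inverse) = gramForm (D ∘L A).inverse
  rw [hr, symPullback_gramForm]

theorem isInvertible_extChartAt_frameBundle_snd (u : FrameBundle n M) :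
    (extChartAt (frameModel n) u u).2.IsInvertible := by
  rw [extChartAt_frameBundle_snd (mem_chart_source _ _)]
  have h : (tangentBundleCore (𝓡 n) M).coordChange
        ((tangentBundleCore (𝓡 n) M).indexAt u.1.1) ((tangentBundleCore (𝓡 n) M).indexAt u.1.1)
        u.1.1 = ContinuousLinearMap.id ℝ _ := by
    ext1 v
    exact (tangentBundleCore (𝓡 n) M).coordChange_self _ _
      ((tangentBundleCore (𝓡 n) M).mem_baseSet_at u.1.1) v
  rw [h]
  exact u.2

/-- `Σ` has smooth local sections through every frame. -/
theorem exists_localSection_frameToSym (u : FrameBundle n M) :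
    ∃ (s : SymPlus n M → FrameBundle n M) (V : Set (SymPlus n M)),
      IsOpen V ∧ frameToSym u ∈ V ∧ s (frameToSym u) = u ∧
      ContMDiffOn (symModel n) (frameModel n) ∞ s V ∧ ∀ σ ∈ V, frameToSym (s σ) = σ := by
  obtain ⟨h, h0, hsm, hsec⟩ :=
    exists_localSection_frameForm (isInvertible_extChartAt_frameBundle_snd u)
  let E := EuclideanSpace ℝ (Fin n)
  let φ := extChartAt (frameModel n) u
  let ψ := extChartAt (symModel n) (frameToSym u)
  have hψu : ψ (frameToSym u) = ((φ u).1, frameForm (φ u).2) :=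
    extChartAt_frameToSym (mem_chart_source _ _)
  -- In coordinates `Σ` is the identity on the base times `frameForm`, so a section only has to lift
  -- the second factor.
  let k : E × symForms n → E × (E →L[ℝ] E) := fun p => (p.1, h p.2)
  have hk0 : k (ψ (frameToSym u)) = φ u := by rw [hψu]; exact Prod.ext rfl h0
  have hψc : ContinuousAt ψ (frameToSym u) := continuousAt_extChartAt _
  have hψ2 : Filter.Tendsto (fun σ => (ψ σ).2) (nhds (frameToSym u)) (nhds (frameForm (φ u).2)) := by
    have := continuousAt_snd.comp hψc
    rwa [ContinuousAt, Function.comp_apply, hψu] at this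
  have hkc : ContinuousAt (fun σ => k (ψ σ)) (frameToSym u) := by
    refine (continuousAt_fst.comp hψc).prodMk (ContinuousAt.comp (g := h) ?_ (continuousAt_snd.comp hψc))
    change ContinuousAt h (ψ (frameToSym u)).2
    rw [hψu]
    exact hsm.self_of_nhds.continuousAt
  have e1 : ∀ᶠ σ in nhds (frameToSym u), σ ∈ ψ.source := extChartAt_source_mem_nhds _
  have e2 : ∀ᶠ σ in nhds (frameToSym u), k (ψ σ) ∈ φ.target := by
    refine hkc.eventually ?_
    change ∀ᶠ y in nhds (k (ψ (frameToSym u))), y ∈ φ.target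
    rw [hk0]
    exact extChartAt_target_mem_nhds u
  obtain ⟨V, hV, hVo, hVu⟩ := eventually_nhds_iff.1
    (e1.and (e2.and ((hψ2.eventually hsm).and (hψ2.eventually hsec))))
  refine ⟨fun σ => φ.symm (k (ψ σ)), V, hVo, hVu, ?_, ?_, ?_⟩
  · change φ.symm (k (ψ (frameToSym u))) = u
    rw [hk0]
    exact extChartAt_to_inv u
  · intro σ hσ
    obtain ⟨h1, h2, h3, -⟩ := hV σ hσ
    have s1 : ContMDiffAt (symModel n) 𝓘(ℝ, E × symForms n) ∞ ψ σ :=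
      contMDiffAt_extChartAt' (by rwa [← extChartAt_source (symModel n)])
    have s2 : ContDiffAt ℝ ∞ k (ψ σ) :=
      contDiffAt_fst.prodMk (ContDiffAt.comp (g := h) (ψ σ) h3 contDiffAt_snd)
    have s3 : ContMDiffAt 𝓘(ℝ, E × (E →L[ℝ] E)) (frameModel n) ∞ φ.symm (k (ψ σ)) :=
      (contMDiffOn_extChartAt_symm u).contMDiffAt
        ((isOpen_extChartAt_target u).mem_nhds h2)
    exact (s3.comp σ (s2.contMDiffAt.comp σ s1)).contMDiffWithinAt
  · intro σ hσ
    obtain ⟨h1, h2, -, h4⟩ := hV σ hσ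
    have hs : φ.symm (k (ψ σ)) ∈ φ.source := φ.map_target h2
    have hs' : frameProj (φ.symm (k (ψ σ))) ∈ (chartAt E (frameProj u)).source :=
      isFstInCharts_frameProj.mapsTo (by rwa [← extChartAt_source (frameModel n)])
    -- The section identity is checked in the chart `ψ`, which is injective on its source.
    refine ψ.injOn ?_ h1 ?_
    · rw [extChartAt_source]
      exact mem_chartAt_source_symPlus hs'
    · refine (extChartAt_frameToSym hs').trans ?_
      change ((φ (φ.symm (k (ψ σ)))).1, frameForm (φ (φ.symm (k (ψ σ)))).2) = ψ σ
      rw [φ.right_inv h2]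
      exact Prod.ext rfl h4

/-- Coordinate changes act on the left of a frame and `a` on the right, so in every chart the action
is composition with the constant map `a`. -/
theorem contMDiff_frameAct (a : EuclideanSpace ℝ (Fin n) ≃L[ℝ] EuclideanSpace ℝ (Fin n)) :
    ContMDiff (frameModel n) (frameModel n) ∞ (frameAct (M := M) a) := by
  rw [← ContMDiff.subtypeVal_comp_iff]
  intro u
  rw [Bundle.contMDiffAt_totalSpace]
  refine ⟨contMDiff_frameProj u, ?_⟩
  let E := EuclideanSpace ℝ (Fin n)
  have h1 : ContMDiffAt (frameModel n) 𝓘(ℝ, E →L[ℝ] E) ∞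
      (fun p : FrameBundle n M => (extChartAt (frameModel n) u p).2) u :=
    ContMDiffAt.comp u (I' := 𝓘(ℝ, E × (E →L[ℝ] E))) contDiffAt_snd.contMDiffAt contMDiffAt_extChartAt
  have h2 : ContMDiffAt (frameModel n) 𝓘(ℝ, E →L[ℝ] E) ∞
      (fun p : FrameBundle n M => (extChartAt (frameModel n) u p).2 ∘L a.toContinuousLinearMap) u :=
    h1.clm_comp contMDiffAt_const
  refine h2.congr_of_eventuallyEq ?_
  filter_upwards [(chartAt (ModelProd E (E →L[ℝ] E)) u).open_source.mem_nhds
    (mem_chart_source _ u)] with p hp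
  have hp' := isFstInCharts_frameProj.mapsTo hp
  rw [extChartAt_frameBundle_snd hp']
  exact extChartAt_frameBundle_snd (u₀ := frameAct a u) (u := frameAct a p) hp'

theorem exists_frameToSym_eq (σ : SymPlus n M) : ∃ u : FrameBundle n M, frameToSym u = σ := by
  obtain ⟨⟨x, B⟩, hB⟩ := σ
  obtain ⟨A, hA, hAB⟩ := exists_frameForm_eq (n := n) B hB
  exact ⟨⟨⟨x, A⟩, hA⟩, Subtype.ext (congrArg (Bundle.TotalSpace.mk (E := (symCore n M).Fiber) x) hAB)⟩

/-- Two frames with the same form differ by an isometry, whose action preserves `Σ`. -/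
theorem exists_frameAct_eq {u u' : FrameBundle n M} (h : frameToSym u = frameToSym u') :
    ∃ a : EuclideanSpace ℝ (Fin n) ≃L[ℝ] EuclideanSpace ℝ (Fin n),
      frameAct a u = u' ∧ ∀ w : FrameBundle n M, frameToSym (frameAct a w) = frameToSym w := by
  obtain ⟨⟨x, A⟩, hA⟩ := u
  obtain ⟨⟨x', A'⟩, hA'⟩ := u'
  have hx : x = x' := congrArg symProj h
  subst hx
  have hAA : frameForm (n := n) A = frameForm (n := n) A' :=
    (Bundle.TotalSpace.mk_inj (F := symForms n) (E := (symCore n M).Fiber)).1 (congrArg Subtype.val h)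
  obtain ⟨a, ha, hiso⟩ := exists_isometry_of_frameForm_eq (n := n) hA hA' hAA
  refine ⟨a, Subtype.ext (congrArg (Bundle.TotalSpace.mk (E := (fun x : M =>
    Bundle.Trivial M (EuclideanSpace ℝ (Fin n)) x →L[ℝ] TangentSpace (𝓡 n) x)) x) ha), ?_⟩
  rintro ⟨⟨y, C⟩, hC⟩
  exact Subtype.ext (congrArg (Bundle.TotalSpace.mk (E := (symCore n M).Fiber) y)
    (frameForm_comp_isometry (n := n) hC hiso))

end Frames


/-! ### Complements of kernels. -/

section LinearAlgebra

variable {V W X : Type*} [AddCommGroup V] [Module ℝ V] [AddCommGroup W] [Module ℝ W]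
  [AddCommGroup X] [Module ℝ X]

theorem existsUnique_mem_apply_eq {f : V →ₗ[ℝ] W} (hf : Function.Surjective f)
    {D : Submodule ℝ V} (h : IsCompl D f.ker) (w : W) : ∃! v, v ∈ D ∧ f v = w := by
  obtain ⟨x, rfl⟩ := hf w
  obtain ⟨d, hd, k, hk, rfl⟩ := Submodule.mem_sup.1 (h.sup_eq_top ▸ Submodule.mem_top (x := x))
  have hk' : f k = 0 := hk
  refine ⟨d, ⟨hd, by rw [map_add, hk', add_zero]⟩, ?_⟩
  rintro d' ⟨hd', he⟩
  rw [map_add, hk', add_zero] at he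
  refine sub_eq_zero.1 (Submodule.disjoint_def.1 h.disjoint _ (D.sub_mem hd' hd) ?_)
  rw [LinearMap.mem_ker, map_sub, he, sub_self]

theorem disjoint_ker_of_isCompl_ker_comp {g : V →ₗ[ℝ] W} {f : W →ₗ[ℝ] X} {D : Submodule ℝ V}
    (h : IsCompl D (f ∘ₗ g).ker) : Disjoint D g.ker :=
  h.disjoint.mono_right (LinearMap.ker_le_ker_comp g f)

/-- A vector of the image killed by `f` comes from `D ∩ ker (f ∘ g) = 0`. To decompose `w`, lift `f
w` to some `d` in `D`; then `w - g d` lies in `ker f`. -/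
theorem isCompl_map_ker {g : V →ₗ[ℝ] W} {f : W →ₗ[ℝ] X} (hfg : Function.Surjective (f ∘ₗ g))
    {D : Submodule ℝ V} (h : IsCompl D (f ∘ₗ g).ker) : IsCompl (D.map g) f.ker := by
  refine ⟨?_, ?_⟩
  · rw [Submodule.disjoint_def]
    rintro _ ⟨d, hd, rfl⟩ hk
    rw [Submodule.disjoint_def.1 h.disjoint d hd hk, map_zero]
  · rw [codisjoint_iff, Submodule.eq_top_iff']
    intro w
    obtain ⟨d, ⟨hd, he⟩, -⟩ := existsUnique_mem_apply_eq hfg h (f w)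
    refine Submodule.mem_sup.2 ⟨g d, Submodule.mem_map_of_mem hd, w - g d, ?_, by abel⟩
    rw [LinearMap.mem_ker, map_sub, sub_eq_zero]
    exact he.symm

end LinearAlgebra

/-! ### Push-forward of smooth distributions. -/

section SmoothPushforward

variable {E F H K N P : Type*} [NormedAddCommGroup E] [NormedSpace ℝ E]
  [NormedAddCommGroup F] [NormedSpace ℝ F]
  [TopologicalSpace H] {I : ModelWithCorners ℝ E H}
  [TopologicalSpace K] {J : ModelWithCorners ℝ F K}
  [TopologicalSpace N] [ChartedSpace H N] [IsManifold I ∞ N]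
  [TopologicalSpace P] [ChartedSpace K P] [IsManifold J ∞ P]

/-- The push-forward of a smooth vector field along a local section of a smooth map is smooth. -/
theorem contMDiffOn_mfderiv_comp_section {f : N → P} (hf : ContMDiff I J ∞ f)
    {X : ∀ q : N, TangentSpace I q} {U : Set N}
    (hX : ContMDiffOn I I.tangent ∞ (fun q => (⟨q, X q⟩ : TangentBundle I N)) U)
    {s : P → N} {W : Set P} (hs : ContMDiffOn J I ∞ s W) (hsU : Set.MapsTo s W U)
    (hfs : ∀ p ∈ W, f (s p) = p) :
    ContMDiffOn J J.tangent ∞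
      (fun p => (⟨p, (mfderiv I J f (s p) (X (s p)) : F)⟩ : TangentBundle J P)) W := by
  have h1 : ContMDiff I.tangent J.tangent ∞ (tangentMap I J f) :=
    hf.contMDiff_tangentMap (m := ∞) le_rfl
  refine (h1.comp_contMDiffOn (hX.comp hs hsU)).congr fun p hp => ?_
  -- The vector sits at `f (s p)`, only propositionally equal to `p`; all fibres are copies of `F`,
  -- so the fibre components agree as they stand.
  exact Bundle.TotalSpace.ext (hfs p hp).symm HEq.rfl

/-- The image of a smooth distribution under a surjective smooth map with smooth local sections is
smooth, if the derivative is injective on the distribution. -/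
theorem IsSmoothDistribution.of_map_eq {f : N → P} (hf : ContMDiff I J ∞ f)
    (hsurj : Function.Surjective f)
    (hsec : ∀ q : N, ∃ (s : P → N) (V : Set P), IsOpen V ∧ f q ∈ V ∧ s (f q) = q ∧
      ContMDiffOn J I ∞ s V ∧ ∀ p ∈ V, f (s p) = p)
    {A : ∀ q : N, Submodule ℝ (TangentSpace I q)} (hA : IsSmoothDistribution A)
    (hdisj : ∀ q, Disjoint (A q) (mfderiv I J f q).ker)
    {B : ∀ p : P, Submodule ℝ (TangentSpace J p)}
    (hB : ∀ q, (A q).map (mfderiv I J f q).toLinearMap = B (f q)) :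
    IsSmoothDistribution B := by
  intro p₀
  obtain ⟨q₀, rfl⟩ := hsurj p₀
  obtain ⟨k, U, X, hU, hq₀, hX, hbasis⟩ := hA q₀
  obtain ⟨s, V, hV, hV₀, hs₀, hs, hfs⟩ := hsec q₀
  refine ⟨k, V ∩ s ⁻¹' U, fun i p => (mfderiv I J f (s p) (X i (s p)) : F),
    hs.continuousOn.isOpen_inter_preimage hV hU, ⟨hV₀, by rwa [Set.mem_preimage, hs₀]⟩,
    fun i => ?_, fun p hp => ?_⟩
  · exact contMDiffOn_mfderiv_comp_section hf (hX i) (hs.mono Set.inter_subset_left)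
      (fun p hp => hp.2) fun p hp => hfs p hp.1
  -- Keeping `q` and `p` as independent variables lets `f q = p` be substituted, which avoids
  -- transport between tangent spaces at `f (s p)` and `p`.
  · have key : ∀ (q : N) (p : P), q ∈ U → f q = p →
        LinearIndependent ℝ (fun i => ((mfderiv I J f q (X i q) : F) : TangentSpace J p)) ∧
        Submodule.span ℝ (Set.range fun i =>
          ((mfderiv I J f q (X i q) : F) : TangentSpace J p)) = B p := by
      rintro q _ hq rfl
      obtain ⟨hli, hspan⟩ := hbasis q hq
      refine ⟨hli.map (f := (mfderiv I J f q).toLinearMap) ?_, ?_⟩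
      · rw [hspan]
        exact hdisj q
      · rw [← hB q, ← hspan, Submodule.map_span, ← Set.range_comp]
        rfl
    exact key (s p) p hp.2 (hfs p hp.1)

end SmoothPushforward

/-! ### The image of a principal connection. -/

section Pushforward

variable {n : ℕ} {M : Type*} [TopologicalSpace M] [ChartedSpace (EuclideanSpace ℝ (Fin n)) M]
  [IsManifold (𝓡 n) ∞ M]

theorem mfderiv_frameProj_eq (u : FrameBundle n M) :
    (mfderiv (frameModel n) (𝓡 n) (frameProj (n := n) (M := M)) u).toLinearMap =
      (mfderiv (symModel n) (𝓡 n) symProj (frameToSym u)).toLinearMap ∘ₗ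
        (mfderiv (frameModel n) (symModel n) frameToSym u).toLinearMap :=
  congrArg ContinuousLinearMap.toLinearMap (mfderiv_comp (I' := symModel n) u
    (contMDiff_symProj.mdifferentiableAt (x := frameToSym u) (by simp))
    (contMDiff_frameToSym.mdifferentiableAt (x := u) (by simp)))

variable {𝓗 : ∀ u : FrameBundle n M, Submodule ℝ (TangentSpace (frameModel n) u)}

/-- The image of a principal connection under `Σ_*` depends only on the base point. -/
theorem IsPrincipalConnection.heq_map_mfderiv_frameToSym (h𝓗 : IsPrincipalConnection 𝓗)
    {u u' : FrameBundle n M} (h : frameToSym u = frameToSym u') :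
    HEq ((𝓗 u').map (mfderiv (frameModel n) (symModel n) frameToSym u').toLinearMap)
      ((𝓗 u).map (mfderiv (frameModel n) (symModel n) frameToSym u).toLinearMap) := by
  obtain ⟨a, rfl, ha⟩ := exists_frameAct_eq h
  rw [← h𝓗.invariant a u, ← Submodule.map_comp]
  have hcomp := congrArg ContinuousLinearMap.toLinearMap
    (mfderiv_comp (I := frameModel n) (I' := frameModel n) (I'' := symModel n) u
    (contMDiff_frameToSym.mdifferentiableAt (x := frameAct a u) (by simp))
    ((contMDiff_frameAct a).mdifferentiableAt (x := u) (by simp)))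
  -- Replacing `Σ ∘ R_a` by `Σ` changes the type of the derivative, so the map is generalized first
  -- and the comparison is heterogeneous.
  have key : ∀ f : FrameBundle n M → SymPlus n M, f = frameToSym →
      HEq ((𝓗 u).map (mfderiv (frameModel n) (symModel n) f u).toLinearMap)
        ((𝓗 u).map (mfderiv (frameModel n) (symModel n) frameToSym u).toLinearMap) := by
    rintro _ rfl
    rfl
  have h1 := key (frameToSym ∘ frameAct a) (funext ha)
  rw [hcomp] at h1
  exact h1

theorem IsPrincipalConnection.isCompl_map_ker (h𝓗 : IsPrincipalConnection 𝓗)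
    (u : FrameBundle n M) :
    IsCompl ((𝓗 u).map (mfderiv (frameModel n) (symModel n) frameToSym u).toLinearMap)
      (mfderiv (symModel n) (𝓡 n) symProj (frameToSym u)).ker := by
  have h1 := h𝓗.isSmoothSplitting.2.2 u
  have h2 := isFstInCharts_frameProj.surjective_mfderiv u
  refine FrameSym.isCompl_map_ker (f := (mfderiv (symModel n) (𝓡 n) symProj
    (frameToSym u)).toLinearMap) ?_ ?_
  · rw [← mfderiv_frameProj_eq]
    exact h2
  · rw [← mfderiv_frameProj_eq]
    exact h1

theorem IsPrincipalConnection.disjoint_ker_mfderiv_frameToSym (h𝓗 : IsPrincipalConnection 𝓗)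
    (u : FrameBundle n M) :
    Disjoint (𝓗 u) (mfderiv (frameModel n) (symModel n) frameToSym u).ker := by
  have h1 := h𝓗.isSmoothSplitting.2.2 u
  refine disjoint_ker_of_isCompl_ker_comp (f := (mfderiv (symModel n) (𝓡 n) symProj
    (frameToSym u)).toLinearMap) ?_
  rw [← mfderiv_frameProj_eq]
  exact h1

end Pushforward

end
end FrameSym

theorem mainTheorem12 (n : ℕ) (M : Type*) [TopologicalSpace M]
    [ChartedSpace (EuclideanSpace ℝ (Fin n)) M] [IsManifold (𝓡 n) ∞ M]
    (𝓗 : ∀ u : FrameSym.FrameBundle n M, Submodule ℝ (TangentSpace (FrameSym.frameModel n) u))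
    (h𝓗 : FrameSym.IsPrincipalConnection 𝓗) :
    ∃! 𝓗S : ∀ σ : FrameSym.SymPlus n M, Submodule ℝ (TangentSpace (FrameSym.symModel n) σ),
      (∀ u : FrameSym.FrameBundle n M,
        (𝓗 u).map (mfderiv (FrameSym.frameModel n) (FrameSym.symModel n)
          FrameSym.frameToSym u).toLinearMap = 𝓗S (FrameSym.frameToSym u)) ∧
      FrameSym.IsSmoothSplitting 𝓗S
        (fun σ => (mfderiv (FrameSym.symModel n) (𝓡 n) FrameSym.symProj σ).ker) ∧
      ∀ (σ : FrameSym.SymPlus n M) (v : TangentSpace (𝓡 n) (FrameSym.symProj σ)),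
        ∃! w : TangentSpace (FrameSym.symModel n) σ,
          w ∈ 𝓗S σ ∧ mfderiv (FrameSym.symModel n) (𝓡 n) FrameSym.symProj σ w = v := by
  -- The images live over `Σ(u)` rather than `σ`, so independence of the chosen frame is phrased
  -- with `HEq`; it becomes an equality once `σ` is `Σ(u)`.
  have hex : ∀ σ : FrameSym.SymPlus n M,
      ∃ D : Submodule ℝ (TangentSpace (FrameSym.symModel n) σ),
        ∀ u : FrameSym.FrameBundle n M, FrameSym.frameToSym u = σ →
          HEq ((𝓗 u).map (mfderiv (FrameSym.frameModel n) (FrameSym.symModel n)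
            FrameSym.frameToSym u).toLinearMap) D := by
    intro σ
    obtain ⟨u₀, rfl⟩ := FrameSym.exists_frameToSym_eq σ
    exact ⟨_, fun u hu => h𝓗.heq_map_mfderiv_frameToSym hu.symm⟩
  choose 𝓗S h𝓗S using hex
  have hmap : ∀ u : FrameSym.FrameBundle n M,
      (𝓗 u).map (mfderiv (FrameSym.frameModel n) (FrameSym.symModel n)
        FrameSym.frameToSym u).toLinearMap = 𝓗S (FrameSym.frameToSym u) :=
    fun u => eq_of_heq (h𝓗S _ u rfl)
  have hcompl : ∀ σ : FrameSym.SymPlus n M, IsCompl (𝓗S σ)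
      (mfderiv (FrameSym.symModel n) (𝓡 n) FrameSym.symProj σ).ker := by
    intro σ
    obtain ⟨u, rfl⟩ := FrameSym.exists_frameToSym_eq σ
    rw [← hmap u]
    exact h𝓗.isCompl_map_ker u
  refine ⟨𝓗S, ⟨hmap, ⟨.of_map_eq FrameSym.contMDiff_frameToSym
    FrameSym.exists_frameToSym_eq FrameSym.exists_localSection_frameToSym h𝓗.isSmoothSplitting.1
    h𝓗.disjoint_ker_mfderiv_frameToSym hmap,
    FrameSym.isFstInCharts_symProj.isSmoothDistribution_ker, hcompl⟩, fun σ v => ?_⟩, ?_⟩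
  · exact FrameSym.existsUnique_mem_apply_eq
      (FrameSym.isFstInCharts_symProj.surjective_mfderiv σ) (hcompl σ) v
  -- Since `Σ` is surjective, the image condition fixes the value at every point.
  · rintro 𝓓 ⟨h𝓓, -⟩
    funext σ
    obtain ⟨u, rfl⟩ := FrameSym.exists_frameToSym_eq σ
    rw [← h𝓓 u, ← hmap u]
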